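/- **Theorem.** Let $\tau$ be the substitution $1\mapsto 101$, $0\mapsto 1$ on the alphabet $\{0,1\}$, let $\mathbf{s}=(s_n)_{n\ge 0}=\lim_{N\to\infty}\tau^{N}(1)$ be its fixed point, and for $m\ge 0$, $n\ge 1$ let $H_{m,n}=\det\,(s_{m+i+j})_{0\le i,j\le n-1}$. Define $(f_n)_{n\ge 0}$ by $f_{2j}=|\tau^{j}(1)|$ and $f_{2j+1}=|\tau^{j}(10)|$, where $|w|$ is the length of the word $w$; the numbers $f_{2j}$ are odd and the numbers $f_{2j+1}$ are even. Every integer $x\ge 0$ has a unique representation $x=\sum_{i\ge 0}a_i(x)f_i$ with $a_i(x)\in\{0,1\}$, only finitely many of them nonzero, such that $a_i(x)a_{i+1}(x)=0$ for all $i\ge 0$ and $a_i(x)a_{i+2}(x)=0$ for all even $i\ge 0$. For $k\ge 0$ put $\Phi_k(x)=\sum_{i=0}^{2k+2}a_i(x)f_i$. For $k\ge 0$ let $\alpha_1<\alpha_2<\cdots$ (depending on $k$) be the elements, in ascending order, of the infinite set $\{x\in\mathbb{N} : \Phi_{k+1}(x)=f_{2k+5}/2\}$, and let $$U_k=\bigcup_{i\ge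 1}\left\{(m,n)\in\mathbb{N}^2 : f_{2k}\le n<f_{2k+3},\ \alpha_i-f_{2k+2}<n+m\le\alpha_i\right\}.$$ Then for every $k\ge 0$ and every $(m,n)\in U_k$: 1. if $n=f_{2k+3}-1$, then $$H_{m,n}=(-1)^{k+1}(-1)^{\frac{f_{2k+5}}{2}-\Phi_{k+1}(m+n)}\cdot\frac{f_{2k+1}}{2};$$ 2. if $n=f_{2k}$, then $$H_{m,n}=(-1)^{k+1}(-1)^{\frac{f_{2k+2}-1}{2}}\cdot\frac{f_{2k+1}}{2};$$ 3. if $f_{2k}<n<f_{2k+3}-1$ and $m+n=\alpha_i-f_{2k+2}+1$ or $m+n=\alpha_i$ for some $i\ge 1$, then $$H_{m,n}=-(-1)^{(f_{2k+3}-n)k}(-1)^{\frac{(f_{2k+3}-1-n)(f_{2k+3}-2-n)}{2}}\cdot\frac{f_{2k+1}}{2};$$ if $f_{2k}<n<f_{2k+3}-1$ and there is no such $i$, then $H_{m,n}=0$. -/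

import Mathlib

namespace HankelSturm

/-! ### The substitution `1 ↦ 101`, `0 ↦ 1` and its fixed point -/

/-- The substitution on letters: `1 ↦ 101`, `0 ↦ 1`. -/
def tauLetter : Fin 2 → List (Fin 2)
  | 1 => [1, 0, 1]
  | 0 => [1]

/-- The substitution on finite words, extended by concatenation. -/
def tau (w : List (Fin 2)) : List (Fin 2) := w.flatMap tauLetter

/-- The sequence `f`: `f (2j) = |τ^j(1)|` and `f (2j+1) = |τ^j(10)|`. -/
def f (n : ℕ) : ℕ :=
  if Even n then (tau^[n / 2] [1]).length else (tau^[n / 2] [1, 0]).length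

theorem tau_append (u v : List (Fin 2)) : tau (u ++ v) = tau u ++ tau v := by
  simp [tau]

theorem tau_iterate_append (j : ℕ) (u v : List (Fin 2)) :
    tau^[j] (u ++ v) = tau^[j] u ++ tau^[j] v := by
  induction j generalizing u v with
  | zero => rfl
  | succ j ih => simp only [Function.iterate_succ, Function.comp, tau_append, ih]

theorem f_even (j : ℕ) : f (2 * j) = (tau^[j] [1]).length := by
  simp [f]

theorem f_odd (j : ℕ) : f (2 * j + 1) = (tau^[j] [1, 0]).length := by
  have h1 : ¬ Even (2 * j + 1) := by simp
  have h2 : (2 * j + 1) / 2 = j := by omega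
  simp only [f, h1, h2, if_false]

theorem f_rec_even (j : ℕ) : f (2 * j + 2) = f (2 * j + 1) + f (2 * j) := by
  rw [f_odd, f_even, show 2 * j + 2 = 2 * (j + 1) by ring, f_even, Function.iterate_succ_apply,
    show tau [1] = [1, 0] ++ [1] from rfl, tau_iterate_append, List.length_append]

theorem f_rec_odd (j : ℕ) : f (2 * j + 3) = f (2 * j + 2) + f (2 * j) := by
  rw [show 2 * j + 3 = 2 * (j + 1) + 1 by ring, show 2 * j + 2 = 2 * (j + 1) by ring,
    f_odd, f_even, f_even, Function.iterate_succ_apply, Function.iterate_succ_apply,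
    show tau [1, 0] = tau [1] ++ [1] from rfl, tau_iterate_append, List.length_append]

theorem f_zero : f 0 = 1 := rfl

theorem f_one : f 1 = 2 := rfl

/-- The step in the recurrence `f (t + 1) = f t + f (stepBack t)`. -/
def stepBack (t : ℕ) : ℕ := if Even t then t - 2 else t - 1

theorem f_succ (t : ℕ) : f (t + 1) = f t + f (stepBack t) := by
  rcases Nat.even_or_odd' t with ⟨j, rfl | rfl⟩
  · rcases j with _ | j
    · rfl
    · have he : Even (2 * (j + 1)) := even_two_mul _
      have hb : stepBack (2 * (j + 1)) = 2 * j := by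
        rw [stepBack, if_pos he]; omega
      rw [hb]
      exact f_rec_odd j
  · simpa [stepBack] using f_rec_even j

theorem f_pos (t : ℕ) : 0 < f t := by
  induction t with
  | zero => simp [f_zero]
  | succ t ih => rw [f_succ]; omega

theorem f_strictMono : StrictMono f :=
  strictMono_nat_of_lt_succ fun t => by
    have := f_succ t
    have := f_pos (stepBack t)
    omega

theorem f_even_mod (j : ℕ) : f (2 * j) % 2 = 1 ∧ f (2 * j + 1) % 2 = 0 := by
  induction j with
  | zero => simp [f_zero, f_one]
  | succ j ih =>
    have h1 := f_rec_even j
    have h2 := f_rec_odd j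
    rw [show 2 * (j + 1) + 1 = 2 * j + 3 by ring, show 2 * (j + 1) = 2 * j + 2 by ring]
    omega

/-- The fixed point `s = lim τ^N(1)`: its letter of index `n` is that of the word `τ^n(1)`, which
is longer than `n`. -/
def s (n : ℕ) : Fin 2 := (tau^[n] [1]).getD n 0

theorem lt_length_tau_iterate (n : ℕ) : n < (tau^[n] [1]).length := by
  rw [← f_even]
  have h3 : ∀ t, t + 1 ≤ f t := by
    intro t
    induction t with
    | zero => simp [f_zero]
    | succ t ih =>
      have : f t < f (t + 1) := f_strictMono (Nat.lt_succ_self t)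
      omega
  have := h3 (2 * n)
  omega

theorem tau_iterate_prefix {M N : ℕ} (h : M ≤ N) : tau^[M] [1] <+: tau^[N] [1] := by
  induction N, h using Nat.le_induction with
  | base => exact List.prefix_rfl
  | succ N _ ih =>
    refine ih.trans ?_
    rw [Function.iterate_succ_apply, show tau [1] = [1] ++ [0, 1] from rfl, tau_iterate_append]
    exact List.prefix_append _ _

/-- Every word `τ^N(1)` is a prefix of `s`. -/
theorem s_eq (n N : ℕ) (h : n < (tau^[N] [1]).length) : (tau^[N] [1])[n] = s n := by
  have hn := lt_length_tau_iterate n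
  rw [s, List.getD_eq_getElem _ _ hn]
  rcases le_total n N with h' | h'
  · exact ((tau_iterate_prefix h').getElem hn).symm
  · exact (tau_iterate_prefix h').getElem h

/-! ### Hankel determinants -/

/-- The Hankel matrix `(s_{m+i+j})`, `0 ≤ i, j ≤ n-1`. -/
def hankel (m n : ℕ) : Matrix (Fin n) (Fin n) ℤ :=
  Matrix.of fun i j => ((s (m + i + j) : ℕ) : ℤ)

/-- The Hankel determinant `H_{m,n}`. -/
def H (m n : ℕ) : ℤ := (hankel m n).det

/-! ### The `f`-representation

Digit strings `(a_i)` with `a_i ∈ {0,1}` are given by the finite set `S = {i | a_i = 1}`. -/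

/-- The digit conditions: `a_i a_{i+1} = 0` for all `i`, and `a_i a_{i+2} = 0` for all even `i`. -/
def Admissible (S : Finset ℕ) : Prop :=
  ∀ i ∈ S, i + 1 ∉ S ∧ (Even i → i + 2 ∉ S)

/-- `S` is the set of indices of the digits `1` of an `f`-representation of `n`. -/
def IsFRep (S : Finset ℕ) (n : ℕ) : Prop :=
  Admissible S ∧ ∑ i ∈ S, f i = n

theorem Admissible.mono {S T : Finset ℕ} (hT : Admissible T) (h : S ⊆ T) : Admissible S :=
  fun i hi => ⟨fun h' => (hT i (h hi)).1 (h h'), fun he h' => (hT i (h hi)).2 he (h h')⟩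

theorem Admissible.erase_subset {S : Finset ℕ} (hS : Admissible S) {t : ℕ}
    (hsub : S ⊆ Finset.range (t + 1)) (ht : t ∈ S) :
    S.erase t ⊆ Finset.range (stepBack t) := by
  intro i hi
  rw [Finset.mem_erase] at hi
  have hlt : i < t + 1 := Finset.mem_range.1 (hsub hi.2)
  have h1 : i + 1 ≠ t := fun h => (hS i hi.2).1 (h ▸ ht)
  have h2 : Even i → i + 2 ≠ t := fun he h => (hS i hi.2).2 he (h ▸ ht)
  rw [Finset.mem_range, stepBack]
  have := hi.1
  split_ifs with he
  · have : i + 2 ≠ t := fun h => h2 (by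
      rw [← h] at he
      exact (Nat.even_add.1 he).2 even_two) h
    omega
  · omega

theorem Admissible.insert_stepBack {S : Finset ℕ} (hS : Admissible S) {t : ℕ}
    (hsub : S ⊆ Finset.range (stepBack t)) : Admissible (insert t S) := by
  have hb : ∀ i ∈ S, i + 1 < t ∧ (Even i → i + 2 < t ∨ t + 1 < i + 2 ∨ (i + 2 ≠ t)) := by
    intro i hi
    have := Finset.mem_range.1 (hsub hi)
    rw [stepBack] at this
    split_ifs at this with he
    · exact ⟨by omega, fun _ => Or.inl (by omega)⟩
    · refine ⟨by omega, fun hi' => Or.inr (Or.inr fun h => he ?_)⟩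
      rw [← h]
      exact hi'.add even_two
  intro i hi
  rw [Finset.mem_insert] at hi
  rcases hi with rfl | hi
  · refine ⟨fun h => ?_, fun _ h => ?_⟩
    · rcases Finset.mem_insert.1 h with h | h
      · omega
      · have := (hb _ h).1; omega
    · rcases Finset.mem_insert.1 h with h | h
      · omega
      · have := (hb _ h).1; omega
  · refine ⟨fun h => ?_, fun he h => ?_⟩
    · rcases Finset.mem_insert.1 h with h | h
      · have := (hb _ hi).1; omega
      · exact (hS i hi).1 h
    · rcases Finset.mem_insert.1 h with h | h
      · have := (hb _ hi).1
        rcases (hb _ hi).2 he with h' | h' | h' <;> omega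
      · exact (hS i hi).2 he h

theorem stepBack_le (t : ℕ) : stepBack t ≤ t := by
  unfold stepBack; split_ifs <;> omega

theorem sum_lt_of_admissible (t : ℕ) (S : Finset ℕ) (hS : Admissible S)
    (hsub : S ⊆ Finset.range t) : ∑ i ∈ S, f i < f t := by
  induction t using Nat.strong_induction_on generalizing S with
  | _ t ih =>
    rcases t with _ | t
    · have : S = ∅ := by simpa using hsub
      simp [this, f_zero]
    · by_cases ht : t ∈ S
      · have h := ih (stepBack t) (Nat.lt_succ_of_le (stepBack_le t)) (S.erase t)
          (hS.mono (Finset.erase_subset _ _)) (hS.erase_subset hsub ht)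
        rw [← Finset.add_sum_erase S f ht, f_succ]
        omega
      · have h := ih t (Nat.lt_succ_self t) S hS (fun i hi => by
          have h1 := Finset.mem_range.1 (hsub hi)
          have h2 : i ≠ t := fun h => ht (h ▸ hi)
          rw [Finset.mem_range]; omega)
        exact h.trans (f_strictMono (Nat.lt_succ_self t))

theorem exists_admissible (t n : ℕ) (hn : n < f t) :
    ∃ S : Finset ℕ, S ⊆ Finset.range t ∧ IsFRep S n := by
  induction t using Nat.strong_induction_on generalizing n with
  | _ t ih =>
    rcases t with _ | t
    · refine ⟨∅, by simp, by simp [Admissible], ?_⟩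
      rw [f_zero] at hn
      simp; omega
    · by_cases h : n < f t
      · obtain ⟨S, h1, h2⟩ := ih t (Nat.lt_succ_self t) n h
        exact ⟨S, h1.trans (Finset.range_mono (Nat.le_succ t)), h2⟩
      · rw [f_succ] at hn
        obtain ⟨S, h1, h2, h3⟩ := ih (stepBack t) (Nat.lt_succ_of_le (stepBack_le t)) (n - f t)
          (by omega)
        have ht : t ∉ S := fun h' => by
          have := Finset.mem_range.1 (h1 h')
          have := stepBack_le t
          omega
        refine ⟨insert t S, ?_, h2.insert_stepBack h1, ?_⟩
        · intro i hi
          rw [Finset.mem_range]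
          rcases Finset.mem_insert.1 hi with rfl | hi
          · omega
          · have := Finset.mem_range.1 (h1 hi)
            have := stepBack_le t
            omega
        · rw [Finset.sum_insert ht, h3]
          omega

theorem frep_unique_aux (t : ℕ) (S T : Finset ℕ) (hS : Admissible S) (hT : Admissible T)
    (hSs : S ⊆ Finset.range t) (hTs : T ⊆ Finset.range t)
    (h : ∑ i ∈ S, f i = ∑ i ∈ T, f i) : S = T := by
  induction t generalizing S T with
  | zero =>
    have h1 : S = ∅ := by simpa using hSs
    have h2 : T = ∅ := by simpa using hTs
    rw [h1, h2]
  | succ t ih =>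
    have key : ∀ R : Finset ℕ, R ⊆ Finset.range (t + 1) → t ∉ R → R ⊆ Finset.range t := by
      intro R hR ht i hi
      have h1 := Finset.mem_range.1 (hR hi)
      have h2 : i ≠ t := fun h => ht (h ▸ hi)
      rw [Finset.mem_range]; omega
    by_cases h1 : t ∈ S <;> by_cases h2 : t ∈ T
    · have := ih (S.erase t) (T.erase t) (hS.mono (Finset.erase_subset _ _))
        (hT.mono (Finset.erase_subset _ _))
        (key _ ((Finset.erase_subset _ _).trans hSs) (Finset.notMem_erase _ _))
        (key _ ((Finset.erase_subset _ _).trans hTs) (Finset.notMem_erase _ _))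
        (by rw [← Finset.add_sum_erase S f h1, ← Finset.add_sum_erase T f h2] at h; omega)
      rw [← Finset.insert_erase h1, this, Finset.insert_erase h2]
    · have hb := sum_lt_of_admissible t T hT (key _ hTs h2)
      rw [← h, ← Finset.add_sum_erase S f h1] at hb
      omega
    · have hb := sum_lt_of_admissible t S hS (key _ hSs h1)
      rw [h, ← Finset.add_sum_erase T f h2] at hb
      omega
    · exact ih S T hS hT (key _ hSs h1) (key _ hTs h2) h

/-- Every natural number has exactly one `f`-representation. -/
theorem existsUnique_frep (n : ℕ) : ∃! S : Finset ℕ, IsFRep S n := by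
  obtain ⟨S, -, hS⟩ := exists_admissible (n + 1) n
    (lt_of_lt_of_le (Nat.lt_succ_self n) f_strictMono.le_apply)
  refine ⟨S, hS, fun T hT => ?_⟩
  obtain ⟨t, ht⟩ : ∃ t, S ∪ T ⊆ Finset.range t := Finset.exists_nat_subset_range _
  exact frep_unique_aux t T S hT.1 hS.1 (Finset.subset_union_right.trans ht)
    (Finset.subset_union_left.trans ht) (hT.2.trans hS.2.symm)

/-- The set of indices of the digits `1` in the `f`-representation of `n`. -/
noncomputable def frep (n : ℕ) : Finset ℕ := (existsUnique_frep n).choose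

theorem frep_spec (n : ℕ) : IsFRep (frep n) n := (existsUnique_frep n).choose_spec.1

theorem frep_eq {S : Finset ℕ} {n : ℕ} (h : IsFRep S n) : frep n = S :=
  (existsUnique_frep n).unique (frep_spec n) h

/-- The digit `a_i(n)` of the `f`-representation `n = ∑ a_i(n) f_i`. -/
noncomputable def digit (i n : ℕ) : ℕ := if i ∈ frep n then 1 else 0

/-- The truncated `f`-representation `Φ_k(n) = ∑_{i=0}^{2k+2} a_i(n) f_i`. -/
noncomputable def Phi (k n : ℕ) : ℕ := ∑ i ∈ Finset.range (2 * k + 3), digit i n * f i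

/-! ### The parallelograms -/

/-- The set `E'_k = {x : Φ_k(x) = f_{2k+3} / 2}`; the number `f_{2k+3}` is even. -/
def EPrime (k : ℕ) : Set ℕ := {x | Phi k x = f (2 * k + 3) / 2}

theorem EPrime_infinite (k : ℕ) : (EPrime k).Infinite := by
  rw [Set.infinite_iff_exists_gt]
  intro b
  set x := f (2 * k + 3) / 2 with hx
  obtain ⟨S, hS, hSa, hSs⟩ := exists_admissible (2 * k + 3) x (by have := f_pos (2 * k + 3); omega)
  set N := 2 * k + 6 + b with hN
  have hlt : ∀ i ∈ S, i < 2 * k + 3 := fun i hi => Finset.mem_range.1 (hS hi)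
  have hNS : N ∉ S := fun h => by have := hlt _ h; omega
  have hrep : IsFRep (insert N S) (f N + x) := by
    refine ⟨hSa.insert_stepBack fun i hi => ?_, by rw [Finset.sum_insert hNS, hSs]⟩
    have := hlt i hi
    rw [Finset.mem_range, stepBack]
    split_ifs <;> omega
  refine ⟨f N + x, ?_, ?_⟩
  · change Phi k (f N + x) = x
    rw [Phi]
    simp only [digit, frep_eq hrep, ite_mul, one_mul, zero_mul]
    rw [← Finset.sum_filter, ← hSs]
    congr 1
    ext i
    simp only [Finset.mem_filter, Finset.mem_range, Finset.mem_insert]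
    constructor
    · rintro ⟨h1, rfl | h2⟩
      · omega
      · exact h2
    · exact fun h => ⟨hlt i h, Or.inr h⟩
  · have := f_strictMono.le_apply (x := N)
    omega

/-- The elements `α_1 < α_2 < ⋯` of the infinite set `E'_{k+1}` in ascending order, indexed by
`i ≥ 1`. -/
noncomputable def alpha (k i : ℕ) : ℕ := Nat.nth (fun x => x ∈ EPrime (k + 1)) (i - 1)

/-- The parallelogram `U_{k,i}`:
`f_{2k} ≤ n < f_{2k+3}` and `α_i - f_{2k+2} < n + m ≤ α_i`. -/
def Uki (k i : ℕ) : Set (ℕ × ℕ) :=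
  {p | f (2 * k) ≤ p.2 ∧ p.2 < f (2 * k + 3) ∧
    (alpha k i : ℤ) - (f (2 * k + 2) : ℤ) < (p.2 : ℤ) + (p.1 : ℤ) ∧ p.2 + p.1 ≤ alpha k i}

/-- `U_k`, the union of the parallelograms `U_{k,i}` over `i ≥ 1`. -/
def U (k : ℕ) : Set (ℕ × ℕ) := ⋃ i ≥ 1, Uki k i

end HankelSturm

open HankelSturm

/-!
# Hankel determinants of the fixed point of `1 ↦ 101`, `0 ↦ 1`

Write `p = f (2 * k)`, `q = f (2 * k + 2)`, so that `p + q = f (2 * k + 3)`. A point `α` of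
`E'_(k+1)` marks a maximal run of the period `p` in `s`: the difference
`d x = s (x + p) - s x` vanishes for `α - (p + q) < x < α - 1` and is `(-1) ^ k` at `α - (p + q)`
and `-(-1) ^ k` at `α - 1` (`exists_run_of_mem_EPrime`). This holds because

* adding to `x` the part of an `f`-representation with large indices does not change the letter
  `s x` (`exists_base_of_mem_EPrime`), so that near `α` the sequence looks as it does near
  `f (2 * k + 5) / 2`, inside the prefix `τ^(k+2)(1) = τ^k(1011101)`;
* the words `τ^k(10)` and `τ^k(01)` differ by the exchange of their two middle letters
  (`tau_iterate_swap`), so that `d` is known on that prefix (`sInt_sub_eq`).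

Subtracting row `i` from row `i + p` in the Hankel matrix of size `n ≥ p` at `m` turns all rows but
the first `p` into values of `d`. In the interior of the parallelogram one of these rows is zero
(`H_interior`). On the boundary of the parallelogram the rows of differences form an antitriangle
in the first `b` and an antitriangle in the last `e` columns, where `n = p + b + e`, and the
determinant is, up to sign, the one of size `p` at `m + b` (`H_border`).

What remains is the Hankel determinant of size `p` of the `p`-periodic word `τ^k(1)^∞`
(`natDet_hankel_period`). It does not depend on the position, as `p` is odd and a shift is a
cyclic permutation of the columns. Its absolute value is the number `f (2 * k + 1) / 2` of letters
`1` in a period, by induction on `k`: in the determinant of size `q`, replace one column by the sum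
of all, which is constant, and subtract rows at distance `p`; the lower right block becomes
antitriangular and the upper left block is the determinant of size `p` with one column replaced by
the same kind of sum (`natDet_hankel_step`).
-/

namespace HankelSturm

/-! ### Determinants of corners of infinite matrices -/

/-- The determinant of the `n × n` corner of an infinite matrix. Indexing the entries by natural
numbers keeps index arithmetic out of `Fin`. -/
def natDet (n : ℕ) (F : ℕ → ℕ → ℤ) : ℤ := (Matrix.of fun i l : Fin n => F i l).det

theorem natDet_congr {n : ℕ} {F G : ℕ → ℕ → ℤ} (h : ∀ i < n, ∀ l < n, F i l = G i l) :
    natDet n F = natDet n G := by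
  unfold natDet
  congr 1
  ext i l
  exact h i i.2 l l.2

theorem natDet_zero (F : ℕ → ℕ → ℤ) : natDet 0 F = 1 := Matrix.det_fin_zero

theorem natDet_one (F : ℕ → ℕ → ℤ) : natDet 1 F = F 0 0 := Matrix.det_fin_one _

/-- Expansion along a row with a single nonzero entry. -/
theorem natDet_succ_of_row {n r c : ℕ} {F : ℕ → ℕ → ℤ} (hr : r ≤ n) (hc : c ≤ n)
    (h : ∀ l ≤ n, l ≠ c → F r l = 0) :
    natDet (n + 1) F = (-1) ^ (r + c) * F r c *
      natDet n fun i l => F (if i < r then i else i + 1) (if l < c then l else l + 1) := by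
  have key : ∀ (a : ℕ) (ha : a < n + 1) (i : Fin n),
      (((⟨a, ha⟩ : Fin (n + 1)).succAbove i : Fin (n + 1)) : ℕ) =
        if (i : ℕ) < a then (i : ℕ) else i + 1 := by
    intro a ha i
    simp only [Fin.succAbove, Fin.lt_def, Fin.val_castSucc]
    split_ifs <;> rfl
  unfold natDet
  rw [Matrix.det_succ_row _ (⟨r, by omega⟩ : Fin (n + 1)),
    Finset.sum_eq_single (⟨c, by omega⟩ : Fin (n + 1))]
  · simp only [Matrix.of_apply]
    congr 2
    ext i l
    simp only [Matrix.submatrix_apply, Matrix.of_apply, key]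
  · intro l _ hl
    have : F r l = 0 := h l (by omega) fun h' => hl (Fin.ext h')
    simp [this]
  · simp

theorem natDet_eq_zero_of_row {n r : ℕ} {F : ℕ → ℕ → ℤ} (hr : r < n)
    (h : ∀ l < n, F r l = 0) : natDet n F = 0 :=
  Matrix.det_eq_zero_of_row_eq_zero (⟨r, hr⟩ : Fin n) fun l => h l l.2

/-- Subtracting row `i - p` from row `i`, for all `i ≥ p` at once. -/
theorem natDet_sub_rows {n p : ℕ} (hp : 0 < p) (F : ℕ → ℕ → ℤ) :
    natDet n F = natDet n fun i l => if i < p then F i l else F i l - F (i - p) l := by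
  set L : Matrix (Fin n) (Fin n) ℤ :=
    Matrix.of fun i l => if (l : ℕ) = i then 1 else if (l : ℕ) + p = i then -1 else 0 with hL
  have hdet : L.det = 1 := by
    rw [Matrix.det_of_isLowerTriangular]
    · simp [hL]
    · intro i l hil
      have : (i : ℕ) < l := hil
      simp only [hL, Matrix.of_apply]
      rw [if_neg (by omega), if_neg (by omega)]
  unfold natDet
  rw [← one_mul (Matrix.det _), ← hdet, ← Matrix.det_mul]
  congr 1
  ext i l
  simp only [Matrix.mul_apply, hL, Matrix.of_apply]
  split_ifs with hi
  · rw [Finset.sum_eq_single i]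
    · simp
    · intro x _ hx
      rw [if_neg (fun h => hx (Fin.ext h)), if_neg (by omega), zero_mul]
    · simp
  · have hne : i ≠ (⟨i - p, by omega⟩ : Fin n) := by
      intro h
      have := congrArg Fin.val h
      simp only at this
      omega
    rw [Fintype.sum_eq_add i (⟨i - p, by omega⟩ : Fin n) hne]
    · rw [if_pos rfl, if_neg (by simp only; omega), if_pos (by simp only; omega)]
      ring
    · rintro x ⟨h1, h2⟩
      rw [if_neg (fun h => h1 (Fin.ext h)), if_neg, zero_mul]
      intro h
      exact h2 (Fin.ext (by simp only; omega))

theorem choose_two_succ (e : ℕ) : (e + 1) * e / 2 = e + e * (e - 1) / 2 := by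
  have h1 := Nat.choose_two_right (e + 1)
  have h2 := Nat.choose_two_right e
  have h3 := Nat.choose_succ_succ' e 1
  simp only [Nat.add_sub_cancel, Nat.choose_one_right, Nat.reduceAdd] at h1 h3
  omega

/-- The last `e` rows vanish to the left of the antidiagonal of the last `e` columns. -/
theorem natDet_antitriangular_right (e : ℕ) : ∀ {n : ℕ} {F : ℕ → ℕ → ℤ} {δ : ℤ},
    (∀ i < e, ∀ l, l + i + 1 < n + e → F (n + i) l = 0) →
    (∀ i < e, ∀ l, l + i + 1 = n + e → F (n + i) l = δ) →
    natDet (n + e) F = (-1) ^ (e * (e - 1) / 2) * δ ^ e * natDet n F := by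
  induction e with
  | zero => intro n F δ _ _; simp
  | succ e ih =>
    intro n F δ h0 h1
    rw [← add_assoc, natDet_succ_of_row (r := n) (c := n + e) (by omega) le_rfl
      (fun l hl hl' => h0 0 (by omega) l (by omega)), ih (δ := δ)]
    · have h2 : F n (n + e) = δ := h1 0 (by omega) _ (by omega)
      have h3 : natDet n (fun i l => F (if i < n then i else i + 1)
          (if l < n + e then l else l + 1)) = natDet n F :=
        natDet_congr fun i hi l hl => by rw [if_pos hi, if_pos (by omega)]
      rw [h2, h3, Nat.add_sub_cancel, choose_two_succ, ← add_assoc, pow_add, pow_add _ e,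
        (Even.add_self n).neg_one_pow]
      ring
    · intro i hi l hl
      rw [if_neg (by omega), if_pos (by omega)]
      exact h0 (i + 1) (by omega) l (by omega)
    · intro i hi l hl
      rw [if_neg (by omega), if_pos (by omega)]
      exact h1 (i + 1) (by omega) l (by omega)

/-- The last `b` rows vanish to the right of the antidiagonal of the first `b` columns. -/
theorem natDet_antitriangular_left (b : ℕ) : ∀ {p : ℕ} {F : ℕ → ℕ → ℤ} {δ : ℤ},
    (∀ i < b, ∀ l < p + b, b < l + i + 1 → F (p + i) l = 0) →
    (∀ i < b, ∀ l, l + i + 1 = b → F (p + i) l = δ) →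
    natDet (p + b) F =
      (-1) ^ (p * b + b * (b - 1) / 2) * δ ^ b * natDet p fun i l => F i (b + l) := by
  induction b with
  | zero => intro p F δ _ _; simp
  | succ b ih =>
    intro p F δ h0 h1
    rw [← add_assoc, natDet_succ_of_row (r := p + b) (c := 0) le_rfl (by omega)
      (fun l hl hl' => h0 b (by omega) l (by omega) (by omega)), ih (δ := δ)]
    · have h2 : F (p + b) 0 = δ := h1 b (by omega) _ (by omega)
      have h3 : natDet p (fun i l => F (if i < p + b then i else i + 1)
          (if b + l < 0 then b + l else b + l + 1)) = natDet p fun i l => F i (b + 1 + l) :=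
        natDet_congr fun i hi l hl => by
          rw [if_pos (by omega), if_neg (by omega), add_right_comm]
      rw [h2, h3, Nat.add_sub_cancel, choose_two_succ]
      ring
    · intro i hi l hl hl'
      rw [if_pos (by omega), if_neg (by omega)]
      exact h0 i (by omega) _ (by omega) (by omega)
    · intro i hi l hl
      rw [if_pos (by omega), if_neg (by omega)]
      exact h1 i (by omega) _ (by omega)

theorem natDet_blocks {p e : ℕ} {F : ℕ → ℕ → ℤ} (h : ∀ i < e, ∀ l < p, F (p + i) l = 0) :
    natDet (p + e) F = natDet p F * natDet e fun i l => F (p + i) (p + l) := by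
  unfold natDet
  rw [← Matrix.det_submatrix_equiv_self finSumFinEquiv,
    ← Matrix.det_fromBlocks_zero₂₁ _ (Matrix.of fun (i : Fin p) (l : Fin e) => F i (p + l)) _]
  congr 1
  ext i l
  rcases i with i | i <;> rcases l with l | l
  · simp
  · simp
  · simpa using h i i.2 l l.2
  · simp

/-- Replacing a column by the sum of all columns. -/
theorem natDet_sum_col {n c : ℕ} (hc : c < n) (F : ℕ → ℕ → ℤ) :
    natDet n F = natDet n fun i l => if l = c then ∑ x ∈ Finset.range n, F i x else F i l := by
  have h := Matrix.det_updateCol_sum (Matrix.of fun i l : Fin n => F i l) ⟨c, hc⟩ (fun _ => 1)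
  simp only [one_smul] at h
  unfold natDet
  rw [← h]
  congr 1
  ext i l
  simp only [Matrix.updateCol_apply, Matrix.of_apply, Fin.ext_iff]
  split_ifs
  · exact Fin.sum_univ_eq_sum_range (fun x => F i x) n
  · rfl

theorem natDet_const_col {n c : ℕ} (hc : c < n) (F : ℕ → ℕ → ℤ) (a : ℤ) :
    natDet n (fun i l => if l = c then a else F i l) =
      a * natDet n fun i l => if l = c then 1 else F i l := by
  unfold natDet
  have h := Matrix.det_updateCol_smul
    (Matrix.of fun i l : Fin n => if (l : ℕ) = c then 1 else F i l) ⟨c, hc⟩ a (fun _ => 1)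
  convert h using 2
  · ext i l
    simp only [Matrix.updateCol_apply, Matrix.of_apply, Fin.ext_iff]
    split_ifs <;> simp
  · congr 1
    ext i l
    simp only [Matrix.updateCol_apply, Matrix.of_apply, Fin.ext_iff]
    split_ifs <;> rfl

/-! ### Letters of `s` and breaks of the periods `f (2 * k)` -/

theorem length_tau (w : List (Fin 2)) : (tau w).length = w.length + 2 * w.count 1 := by
  induction w with
  | nil => rfl
  | cons a w ih =>
    rw [← List.singleton_append, tau_append, List.length_append, ih]
    fin_cases a <;> simp [tau, tauLetter] <;> omega

theorem count_tau (w : List (Fin 2)) : (tau w).count 1 = w.length + w.count 1 := by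
  induction w with
  | nil => rfl
  | cons a w ih =>
    rw [← List.singleton_append, tau_append, List.count_append, ih]
    fin_cases a <;> simp [tau, tauLetter] <;> omega

theorem length_count_tau_iterate (k : ℕ) :
    (tau^[k] [1]).length + (tau^[k] [0]).length = 2 * (tau^[k] [1]).count 1 ∧
      (tau^[k] [1]).count 1 + (tau^[k] [0]).count 1 = (tau^[k] [1]).length := by
  induction k with
  | zero => decide
  | succ k ih =>
    simp only [Function.iterate_succ_apply', length_tau, count_tau]
    omega

theorem f_odd_eq (k : ℕ) : f (2 * k + 1) = 2 * (tau^[k] [1]).count 1 := by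
  rw [f_odd, show ([1, 0] : List (Fin 2)) = [1] ++ [0] from rfl, tau_iterate_append,
    List.length_append, (length_count_tau_iterate k).1]

/-- The words `τ^k(10)` and `τ^k(01)` differ by the exchange of their two middle letters. -/
theorem tau_iterate_swap (k : ℕ) : ∃ (P R : List (Fin 2)) (a b : Fin 2),
    tau^[k] [1, 0] = P ++ a :: b :: R ∧ tau^[k] [0, 1] = P ++ b :: a :: R ∧
      P.length = R.length ∧ P.count 1 = R.count 1 ∧
      ((b : ℕ) : ℤ) - ((a : ℕ) : ℤ) = -(-1) ^ k := by
  induction k with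
  | zero => exact ⟨[], [], 1, 0, rfl, rfl, rfl, rfl, by simp⟩
  | succ k ih =>
    obtain ⟨P, R, a, b, h1, h2, h3, h4, h5⟩ := ih
    have hcase : (a = 1 ∧ b = 0) ∨ (a = 0 ∧ b = 1) := by
      rcases neg_one_pow_eq_or ℤ k with h | h <;> rw [h] at h5 <;> revert h5 <;>
        fin_cases a <;> fin_cases b <;> simp
    refine ⟨tau P ++ [1], 1 :: tau R, b, a, ?_, ?_, ?_, ?_, ?_⟩
    · rw [Function.iterate_succ_apply', h1]
      rcases hcase with ⟨rfl, rfl⟩ | ⟨rfl, rfl⟩ <;> simp [tau, tauLetter]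
    · rw [Function.iterate_succ_apply', h2]
      rcases hcase with ⟨rfl, rfl⟩ | ⟨rfl, rfl⟩ <;> simp [tau, tauLetter]
    · simp only [List.length_append, List.length_cons, List.length_nil, length_tau]
      omega
    · simp only [List.count_append, List.count_cons, List.count_nil, count_tau, beq_self_eq_true,
        if_true]
      omega
    · rw [pow_succ]; linarith

/-- The sequence `s` with values in `ℤ`. -/
def sInt (n : ℕ) : ℤ := ((s n : ℕ) : ℤ)

theorem s_eq_getD {n N : ℕ} (h : n < (tau^[N] [1]).length) :
    s n = (tau^[N] [1]).getD n 0 := by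
  rw [List.getD_eq_getElem _ _ h, s_eq]

theorem tau_iterate_succ_one (k : ℕ) : tau^[k + 1] [1] = tau^[k] [1, 0] ++ tau^[k] [1] := by
  rw [Function.iterate_succ_apply, show tau [1] = [1, 0] ++ [1] from rfl, tau_iterate_append]

theorem tau_iterate_succ_one' (k : ℕ) : tau^[k + 1] [1] = tau^[k] [1] ++ tau^[k] [0, 1] := by
  rw [Function.iterate_succ_apply, show tau [1] = [1] ++ [0, 1] from rfl, tau_iterate_append]

theorem length_tau_iterate_zero_one (k : ℕ) : (tau^[k] [0, 1]).length = f (2 * k + 1) := by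
  rw [f_odd, show ([1, 0] : List (Fin 2)) = [1] ++ [0] from rfl,
    show ([0, 1] : List (Fin 2)) = [0] ++ [1] from rfl, tau_iterate_append, tau_iterate_append,
    List.length_append, List.length_append, add_comm]

theorem s_eq_getD_one_zero {k x : ℕ} (h : x < f (2 * k + 1)) :
    s x = (tau^[k] [1, 0]).getD x 0 := by
  rw [f_odd] at h
  rw [s_eq_getD (N := k + 1), tau_iterate_succ_one, List.getD_append _ _ _ _ h]
  rw [tau_iterate_succ_one, List.length_append]
  omega

theorem s_add_eq_getD_zero_one {k x : ℕ} (h : x < f (2 * k + 1)) :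
    s (f (2 * k) + x) = (tau^[k] [0, 1]).getD x 0 := by
  have h1 := length_tau_iterate_zero_one k
  rw [s_eq_getD (N := k + 1), tau_iterate_succ_one', List.getD_append_right, f_even,
    Nat.add_sub_cancel_left]
  · rw [f_even]; omega
  · rw [tau_iterate_succ_one', List.length_append, f_even]
    omega

theorem s_f_odd_add {k x : ℕ} (h : x < f (2 * k)) : s (f (2 * k + 1) + x) = s x := by
  rw [f_even] at h
  rw [s_eq_getD (N := k + 1) (n := f (2 * k + 1) + x), tau_iterate_succ_one,
    List.getD_append_right, f_odd, Nat.add_sub_cancel_left, s_eq_getD h]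
  · rw [f_odd]; omega
  · rw [tau_iterate_succ_one, List.length_append, f_odd]
    omega

theorem s_f_even_add {k x : ℕ} (h : x < f (2 * k)) : s (f (2 * k + 2) + x) = s x := by
  have h2 : (tau^[k + 1] [0, 1]) = tau^[k] [1] ++ tau^[k] [1, 0, 1] := by
    rw [Function.iterate_succ_apply, show tau [0, 1] = [1] ++ [1, 0, 1] from rfl,
      tau_iterate_append]
  rw [show 2 * k + 2 = 2 * (k + 1) by ring, s_add_eq_getD_zero_one, h2,
    List.getD_append _ _ _ _ (by rwa [← f_even]), s_eq_getD (by rwa [← f_even])]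
  exact h.trans (f_strictMono (by omega))

/-- Adding `f t` does not change the letter, as long as the digit `t` may be put in front of the
`f`-representation. -/
theorem s_f_add {t x : ℕ} (ht : t ≠ 0) (h : x < f (stepBack t)) : s (f t + x) = s x := by
  rcases Nat.even_or_odd' t with ⟨j, rfl | rfl⟩
  · obtain ⟨j, rfl⟩ : ∃ i, j = i + 1 := ⟨j - 1, by omega⟩
    rw [stepBack, if_pos (even_two_mul _)] at h
    exact s_f_even_add h
  · rw [stepBack, if_neg (by simp)] at h
    exact s_f_odd_add h

theorem sInt_sub_of_lt {k x : ℕ} (hx : x < f (2 * k + 1)) :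
    sInt (x + f (2 * k)) - sInt x =
      if x + 1 = f (2 * k + 1) / 2 then -(-1) ^ k
      else if x = f (2 * k + 1) / 2 then (-1) ^ k else 0 := by
  obtain ⟨P, R, a, b, h1, h2, h3, -, h5⟩ := tau_iterate_swap k
  have hlen : f (2 * k + 1) = 2 * (P.length + 1) := by
    rw [f_odd, h1, List.length_append, List.length_cons, List.length_cons]
    omega
  rw [hlen, Nat.mul_div_cancel_left _ two_pos]
  unfold sInt
  rw [add_comm x, s_add_eq_getD_zero_one hx, s_eq_getD_one_zero hx, h1, h2]
  rcases lt_or_ge x P.length with h | h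
  · rw [List.getD_append _ _ _ _ h, List.getD_append _ _ _ _ h, if_neg (by omega),
      if_neg (by omega), sub_self]
  · obtain ⟨y, rfl⟩ := Nat.exists_eq_add_of_le h
    rw [List.getD_append_right _ _ _ _ h, List.getD_append_right _ _ _ _ h,
      Nat.add_sub_cancel_left]
    rcases y with _ | _ | y
    · simpa using h5
    · rw [if_neg (by omega), if_pos rfl]
      simp only [zero_add, List.getD_cons_succ, List.getD_cons_zero]
      linarith
    · rw [if_neg (by omega), if_neg (by omega)]
      simp

theorem sInt_f_odd_add {k x : ℕ} (h : x < f (2 * k)) : sInt (f (2 * k + 1) + x) = sInt x := by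
  rw [sInt, s_f_odd_add h, sInt]

theorem sInt_f_even_add {k x : ℕ} (h : x < f (2 * k)) : sInt (f (2 * k + 2) + x) = sInt x := by
  rw [sInt, s_f_even_add h, sInt]

/-- The breaks of the period `f (2 * k)` before `f (2 * k + 4)` are the two pairs of middle letters
of the occurrences of `τ^k(10)` at `0` and at `f (2 * k + 3) = |τ^k(1011)|`. -/
theorem sInt_sub_eq {k x : ℕ} (hx : x < f (2 * k + 4)) :
    sInt (x + f (2 * k)) - sInt x =
      if x + 1 = f (2 * k + 1) / 2 ∨ x + 1 = f (2 * k + 1) / 2 + f (2 * k + 3) then -(-1) ^ k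
      else if x = f (2 * k + 1) / 2 ∨ x = f (2 * k + 1) / 2 + f (2 * k + 3) then (-1) ^ k
      else 0 := by
  have e2 := f_rec_even k
  have e3 := f_rec_odd k
  have e4 : f (2 * k + 4) = f (2 * k + 3) + f (2 * k + 2) := f_rec_even (k + 1)
  have h0 := f_pos (2 * k)
  have h1 := f_pos (2 * k + 1)
  have m0 := f_strictMono (show 2 * k < 2 * k + 1 by omega)
  have s3 : ∀ y < f (2 * k + 2), sInt (f (2 * k + 3) + y) = sInt y := fun y hy =>
    sInt_f_odd_add (k := k + 1) hy
  have s4 : ∀ y < f (2 * k + 2), sInt (f (2 * k + 4) + y) = sInt y := fun y hy =>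
    sInt_f_even_add (k := k + 1) hy
  rcases lt_or_ge x (f (2 * k + 1)) with h | h
  · rw [sInt_sub_of_lt h]
    congr 1
    · simp only [eq_iff_iff]; omega
    · congr 1
      simp only [eq_iff_iff]; omega
  rcases lt_or_ge x (f (2 * k + 2)) with h' | h'
  · obtain ⟨y, rfl⟩ := Nat.exists_eq_add_of_le h
    rw [show f (2 * k + 1) + y + f (2 * k) = f (2 * k + 2) + y by omega,
      sInt_f_odd_add (by omega), sInt_f_even_add (by omega), if_neg (by omega), if_neg (by omega),
      sub_self]
  rcases lt_or_ge x (f (2 * k + 3)) with h'' | h''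
  · obtain ⟨y, rfl⟩ := Nat.exists_eq_add_of_le h'
    rw [show f (2 * k + 2) + y + f (2 * k) = f (2 * k + 3) + y by omega,
      s3 _ (by omega), sInt_f_even_add (by omega), if_neg (by omega), if_neg (by omega),
      sub_self]
  obtain ⟨y, rfl⟩ := Nat.exists_eq_add_of_le h''
  rcases lt_or_ge y (f (2 * k + 1)) with hy | hy
  · rw [add_assoc, s3 _ (by omega), s3 _ (by omega), sInt_sub_of_lt hy]
    congr 1
    · simp only [eq_iff_iff]; omega
    · congr 1
      simp only [eq_iff_iff]; omega
  · obtain ⟨z, rfl⟩ := Nat.exists_eq_add_of_le hy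
    rw [show f (2 * k + 3) + (f (2 * k + 1) + z) + f (2 * k) = f (2 * k + 4) + z by omega,
      s3 _ (by omega), sInt_f_odd_add (by omega), s4 _ (by omega), if_neg (by omega),
      if_neg (by omega), sub_self]

theorem sum_getD_eq_count (w : List (Fin 2)) :
    ∑ i ∈ Finset.range w.length, (((w.getD i 0 : Fin 2) : ℕ) : ℤ) = w.count 1 := by
  induction w with
  | nil => simp
  | cons a w ih =>
    rw [List.length_cons, Finset.sum_range_succ']
    simp only [List.getD_cons_succ, List.getD_cons_zero, ih]
    fin_cases a <;> simp

/-- The number of letters `1` in `τ^k(1)` is `f (2 * k + 1) / 2`. -/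
theorem sum_sInt (k : ℕ) :
    ∑ x ∈ Finset.range (f (2 * k)), sInt x = ((f (2 * k + 1) / 2 : ℕ) : ℤ) := by
  rw [f_odd_eq, Nat.mul_div_cancel_left _ two_pos, ← sum_getD_eq_count, f_even]
  refine Finset.sum_congr rfl fun x hx => ?_
  rw [sInt, s_eq_getD (Finset.mem_range.1 hx)]

/-! ### Letters and digits -/

/-- The letter `s n` is `0` exactly if the digit of index `0` of `n` is `1`. -/
theorem s_sum_of_admissible (S : Finset ℕ) (hS : Admissible S) :
    s (∑ i ∈ S, f i) = if 0 ∈ S then 0 else 1 := by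
  induction S using Finset.induction_on_max with
  | empty => rfl
  | insert t S hlt ih =>
    have ht : t ∉ S := fun h => (hlt t h).false
    have hsub : S ⊆ Finset.range (stepBack t) := by
      have := hS.erase_subset (t := t) (fun i hi => ?_) (Finset.mem_insert_self _ _)
      · rwa [Finset.erase_insert ht] at this
      · rcases Finset.mem_insert.1 hi with rfl | hi
        · simp
        · have := hlt i hi
          rw [Finset.mem_range]
          omega
    have hS' : Admissible S := hS.mono (Finset.subset_insert _ _)
    rw [Finset.sum_insert ht]
    rcases Nat.eq_zero_or_pos t with rfl | hpos
    · have : S = ∅ := Finset.eq_empty_of_forall_notMem fun i hi => by simpa using hlt i hi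
      subst this
      rfl
    · rw [s_f_add hpos.ne' (sum_lt_of_admissible _ _ hS' hsub), ih hS']
      congr 1
      simp [hpos.ne]

theorem Phi_eq_sum_filter (k n : ℕ) :
    Phi k n = ∑ i ∈ (frep n).filter (· < 2 * k + 3), f i := by
  rw [Phi]
  simp only [digit, ite_mul, one_mul, zero_mul]
  rw [← Finset.sum_filter]
  congr 1
  ext i
  simp [and_comm]

/-- Around a point of `E'_k` the sequence `s` looks as it does near the origin, and `Φ_k` is the
distance from the left end of that copy of `τ^(k+1)(1)`. -/
theorem exists_base_of_mem_EPrime {k a : ℕ} (ha : a ∈ EPrime k) :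
    ∃ Y, a = Y + f (2 * k + 3) / 2 ∧
      ∀ x < f (2 * k + 2), s (Y + x) = s x ∧ Phi k (Y + x) = x := by
  have ha' : Phi k a = f (2 * k + 3) / 2 := ha
  obtain ⟨hadm, hsum⟩ := frep_spec a
  set S := (frep a).filter (¬ · < 2 * k + 3) with hS
  have hSa : Admissible S := hadm.mono (Finset.filter_subset _ _)
  refine ⟨∑ i ∈ S, f i, ?_, fun x hx => ?_⟩
  · rw [← ha', Phi_eq_sum_filter, add_comm, Finset.sum_filter_add_sum_filter_not, hsum]
  obtain ⟨T, hT, hTa, hTs⟩ := exists_admissible _ x hx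
  have hSge : ∀ i ∈ S, 2 * k + 3 ≤ i := fun i hi => not_lt.1 (Finset.mem_filter.1 hi).2
  have hTlt : ∀ i ∈ T, i < 2 * k + 2 := fun i hi => Finset.mem_range.1 (hT hi)
  have hdisj : Disjoint S T := Finset.disjoint_left.2 fun i h1 h2 => by
    have := hSge i h1
    have := hTlt i h2
    omega
  -- the digit `2 * k + 1` is harmless next to the digit `2 * k + 3`, its index being odd
  have hadm' : Admissible (S ∪ T) := by
    intro i hi
    simp only [Finset.mem_union, not_or] at hi ⊢
    rcases hi with hi | hi
    · have h1 := hSge i hi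
      exact ⟨⟨(hSa i hi).1, fun h => by have := hTlt _ h; omega⟩,
        fun he => ⟨(hSa i hi).2 he, fun h => by have := hTlt _ h; omega⟩⟩
    · have h1 := hTlt i hi
      refine ⟨⟨fun h => by have := hSge _ h; omega, (hTa i hi).1⟩,
        fun he => ⟨fun h => ?_, (hTa i hi).2 he⟩⟩
      have := hSge _ h
      obtain ⟨r, hr⟩ := he
      omega
  have hval : ∑ i ∈ S ∪ T, f i = ∑ i ∈ S, f i + x := by
    rw [Finset.sum_union hdisj, hTs]
  constructor
  · rw [← hval, s_sum_of_admissible _ hadm', ← hTs, s_sum_of_admissible _ hTa]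
    have : 0 ∉ S := fun h => by have := hSge 0 h; omega
    simp [this]
  · rw [Phi_eq_sum_filter, frep_eq ⟨hadm', hval⟩, ← hTs]
    congr 1
    ext i
    simp only [Finset.mem_filter, Finset.mem_union]
    constructor
    · rintro ⟨h | h, h'⟩
      · have := hSge i h; omega
      · exact h
    · intro h
      exact ⟨Or.inr h, by have := hTlt i h; omega⟩

/-! ### Hankel determinants and periodicity -/

/-- The differences of `g` at distance `p` vanish between two breaks, `δ'` on the left, met by `b`
rows, and `δ` on the right, met by `e` rows. -/
theorem natDet_hankel_border {g : ℕ → ℤ} {p m b e : ℕ} {δ' δ : ℤ} (hp : 0 < p)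
    (h0 : ∀ x, b ≤ x → x + 2 ≤ b + (p + b + e) → g (m + x + p) - g (m + x) = 0)
    (h1 : ∀ x, x + 1 = b → g (m + x + p) - g (m + x) = δ')
    (h2 : ∀ x, 0 < e → x + 1 = b + (p + b + e) → g (m + x + p) - g (m + x) = δ) :
    natDet (p + b + e) (fun i l => g (m + i + l)) =
      (-1) ^ (e * (e - 1) / 2) * δ ^ e * ((-1) ^ (p * b + b * (b - 1) / 2) * δ' ^ b *
        natDet p fun i l => g (m + b + i + l)) := by
  have hrow : ∀ i l, (if p + i < p then g (m + (p + i) + l)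
      else g (m + (p + i) + l) - g (m + (p + i - p) + l)) =
      g (m + (i + l) + p) - g (m + (i + l)) := fun i l => by
    rw [if_neg (by omega), Nat.add_sub_cancel_left, show m + (p + i) + l = m + (i + l) + p by ring,
      ← add_assoc m i l]
  rw [natDet_sub_rows hp, natDet_antitriangular_right e (δ := δ),
    natDet_antitriangular_left b (δ := δ')]
  · congr 2
    refine natDet_congr fun i hi l hl => ?_
    rw [if_pos hi]
    congr 1
    ring
  · intro i hi l hl hl'
    rw [hrow]
    exact h0 _ (by omega) (by omega)
  · intro i hi l hl
    rw [hrow]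
    exact h1 _ (by omega)
  · intro i hi l hl
    rw [add_assoc p b i, hrow]
    exact h0 _ (by omega) (by omega)
  · intro i hi l hl
    rw [add_assoc p b i, hrow]
    exact h2 _ (by omega) (by omega)

/-- The `r`-th row of differences at distance `p` vanishes. -/
theorem natDet_hankel_eq_zero {g : ℕ → ℤ} {p m n r : ℕ} (hp : 0 < p) (hr : p + r < n)
    (h : ∀ l < n, g (m + r + l + p) = g (m + r + l)) :
    natDet n (fun i l => g (m + i + l)) = 0 := by
  rw [natDet_sub_rows hp]
  refine natDet_eq_zero_of_row hr fun l hl => ?_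
  rw [if_neg (by omega), Nat.add_sub_cancel_left, ← h l hl,
    show m + (p + r) + l = m + r + l + p by ring, sub_self]

/-- Moving the window of a periodic sequence by one permutes the columns cyclically. -/
theorem natDet_hankel_succ {g : ℕ → ℤ} {p m : ℕ} (hp : Odd p)
    (h : ∀ x < p, g (m + x + p) = g (m + x)) :
    natDet p (fun i l => g (m + 1 + i + l)) = natDet p fun i l => g (m + i + l) := by
  obtain ⟨t, rfl⟩ := hp
  unfold natDet
  have hperm := Matrix.det_permute' (finRotate (2 * t + 1))
    (Matrix.of fun i l : Fin (2 * t + 1) => g (m + i + l))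
  rw [sign_finRotate, Nat.add_sub_cancel, Even.neg_one_pow (even_two_mul t)] at hperm
  simp only [Units.val_one, Int.cast_one, one_mul] at hperm
  rw [← hperm]
  congr 1
  ext i l
  simp only [Matrix.submatrix_apply, Matrix.of_apply, id]
  rcases Nat.lt_or_ge l.1 (2 * t) with hl | hl
  · rw [coe_finRotate_of_ne_last (fun h => by rw [h] at hl; simp at hl)]
    congr 1
    ring
  · have hl' : l = Fin.last (2 * t) := Fin.ext (by simp only [Fin.val_last]; omega)
    rw [hl', finRotate_last, Fin.val_last, Fin.val_zero, add_zero, ← h i i.2]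
    congr 1
    ring

theorem natDet_hankel_eq_of_periodic {g : ℕ → ℤ} {p a b : ℕ} (hp : Odd p) (hab : a ≤ b)
    (h : ∀ x, a ≤ x → x + 2 ≤ b + p → g (x + p) = g x) :
    natDet p (fun i l => g (b + i + l)) = natDet p fun i l => g (a + i + l) := by
  induction b, hab using Nat.le_induction with
  | base => rfl
  | succ b hab ih =>
    rw [natDet_hankel_succ hp fun x hx => h _ (by omega) (by omega),
      ih fun x hx hx' => h x hx (by omega)]

theorem sum_window_eq_of_periodic {g : ℕ → ℤ} {p a b : ℕ} (hab : a ≤ b)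
    (h : ∀ x, a ≤ x → x < b → g (x + p) = g x) :
    ∑ l ∈ Finset.range p, g (b + l) = ∑ l ∈ Finset.range p, g (a + l) := by
  induction b, hab using Nat.le_induction with
  | base => rfl
  | succ b hab ih =>
    rw [← ih fun x hx hx' => h x hx (by omega)]
    have h1 := Finset.sum_range_succ (fun l => g (b + l)) p
    have h2 := Finset.sum_range_succ' (fun l => g (b + l)) p
    have h3 := h b hab (by omega)
    simp only [add_zero] at h2
    rw [h3] at h1
    have h4 : ∑ l ∈ Finset.range p, g (b + 1 + l) = ∑ l ∈ Finset.range p, g (b + (l + 1)) :=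
      Finset.sum_congr rfl fun l _ => by rw [add_assoc, add_comm 1 l]
    linarith

/-- If `g` has constant sums over windows of length `p` and over windows of length `p + N`, and the
differences `g (x + p) - g x` form an antitriangular pattern, then the Hankel determinants of sizes
`p + N` and `p`, each divided by its window sum, agree up to sign. -/
theorem natDet_hankel_step {g : ℕ → ℤ} {p N m : ℕ} {h h' δ : ℤ} (hp : 0 < p)
    (hs : ∀ i < p, ∑ l ∈ Finset.range p, g (m + i + l) = h)
    (hs' : ∀ i < p + N, ∑ l ∈ Finset.range (p + N), g (m + i + l) = h')
    (h0 : ∀ x, x + 3 ≤ p + N → g (m + x + p) - g (m + x) = 0)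
    (h1 : ∀ x, x + 1 = p + N → g (m + x + p) - g (m + x) = δ)
    (h2 : ∀ x, p + N ≤ x → x + 2 ≤ p + N + N → g (m + x + p) - g (m + x) = 0) :
    h * natDet (p + N) (fun i l => g (m + i + l)) =
      h' * ((-1) ^ (N * (N - 1) / 2) * δ ^ N * natDet p fun i l => g (m + i + l)) := by
  have e1 : natDet p (fun i l => g (m + i + l)) =
      h * natDet p fun i l => if l = p - 1 then 1 else g (m + i + l) := by
    rw [natDet_sum_col (c := p - 1) (by omega), ← natDet_const_col (by omega)]
    exact natDet_congr fun i hi l _ => by rw [hs i hi]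
  have e2 : natDet (p + N) (fun i l => g (m + i + l)) =
      h' * natDet (p + N) fun i l => if l = p - 1 then 1 else g (m + i + l) := by
    rw [natDet_sum_col (c := p - 1) (by omega), ← natDet_const_col (by omega)]
    exact natDet_congr fun i hi l _ => by rw [hs' i hi]
  have hrow : ∀ i l, l ≠ p - 1 → (if p + i < p then
        (if l = p - 1 then 1 else g (m + (p + i) + l))
      else (if l = p - 1 then 1 else g (m + (p + i) + l)) -
        if l = p - 1 then 1 else g (m + (p + i - p) + l)) =
      g (m + (i + l) + p) - g (m + (i + l)) := fun i l hl => by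
    rw [if_neg (by omega), if_neg hl, if_neg hl, Nat.add_sub_cancel_left,
      show m + (p + i) + l = m + (i + l) + p by ring, ← add_assoc m i l]
  -- column `p - 1` of ones has differences `0`, so the lower left block vanishes
  rw [e1, e2, natDet_sub_rows hp, natDet_blocks]
  · have e3 := natDet_antitriangular_left N (p := 0) (δ := δ)
      (F := fun i l => g (m + (i + (p + l)) + p) - g (m + (i + (p + l))))
      (fun i hi l hl hl' => h2 _ (by omega) (by omega)) (fun i hi l hl => h1 _ (by omega))
    simp only [zero_add, zero_mul, natDet_zero, mul_one] at e3
    have e4 : natDet N (fun i l => if p + i < p then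
        (if p + l = p - 1 then 1 else g (m + (p + i) + (p + l)))
      else (if p + l = p - 1 then 1 else g (m + (p + i) + (p + l))) -
        if p + l = p - 1 then 1 else g (m + (p + i - p) + (p + l))) =
        (-1) ^ (N * (N - 1) / 2) * δ ^ N := by
      rw [← e3]
      exact natDet_congr fun i _ l _ => hrow i (p + l) (by omega)
    rw [e4, natDet_congr (n := p) (G := fun i l => if l = p - 1 then 1 else g (m + i + l))
      fun i hi l hl => if_pos hi]
    ring
  · intro i hi l hl
    by_cases hl' : l = p - 1
    · rw [if_neg (by omega), if_pos hl', if_pos hl', sub_self]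
    · rw [hrow i l hl']
      exact h0 _ (by omega)

theorem f_odd_le (k : ℕ) : f (2 * k + 1) ≤ 2 * f (2 * k) := by
  have h1 := f_succ (2 * k)
  have h2 := f_strictMono.monotone (stepBack_le (2 * k))
  omega

theorem sInt_add_period {k x : ℕ} (h1 : f (2 * k + 1) ≤ x) (h2 : x < f (2 * k + 3)) :
    sInt (x + f (2 * k)) = sInt x := by
  have e2 := f_rec_even k
  have e3 := f_rec_odd k
  have e4 : f (2 * k + 4) = f (2 * k + 3) + f (2 * k + 2) := f_rec_even (k + 1)
  have p1 := f_pos (2 * k + 1)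
  have par := (f_even_mod k).2
  rw [← sub_eq_zero, sInt_sub_eq (by omega), if_neg (by omega), if_neg (by omega)]

/-- Inside a run of period `f (2 * k + 2)`, the breaks of the period `f (2 * k)` recur with that
larger period: if `m` is the first place after the second pair of breaks in `sInt_sub_eq`, then the
next pair consists of the last two places of the window of length `f (2 * k + 2)` at `m`. -/
theorem sInt_sub_window {k m : ℕ} (hm : m = f (2 * k + 1) / 2 + f (2 * k + 3) + 1) :
    (∀ x, m ≤ x → x + 2 < m + f (2 * k + 2) → sInt (x + f (2 * k)) = sInt x) ∧
    (∀ x, x + 1 = f (2 * k + 2) → sInt (m + x + f (2 * k)) - sInt (m + x) = (-1) ^ k) ∧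
    (∀ x, f (2 * k + 2) ≤ x → x + 2 ≤ f (2 * k + 2) + f (2 * k + 1) →
      sInt (m + x + f (2 * k)) - sInt (m + x) = 0) := by
  have e2 := f_rec_even k
  have e3 := f_rec_odd k
  have e4 : f (2 * k + 4) = f (2 * k + 3) + f (2 * k + 2) := f_rec_even (k + 1)
  have e5 : f (2 * k + 5) = f (2 * k + 4) + f (2 * k + 2) := f_rec_odd (k + 1)
  have p1 := f_pos (2 * k + 1)
  have le1 := f_odd_le k
  have par1 := (f_even_mod k).2
  have d0 : ∀ x, m ≤ x → x < f (2 * k + 4) → sInt (x + f (2 * k)) - sInt x = 0 :=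
    fun x h1 h2 => by
      rw [sInt_sub_eq h2, if_neg (by omega), if_neg (by omega)]
  have per : ∀ x, f (2 * k + 3) ≤ x → x < f (2 * k + 5) →
      sInt (x + f (2 * k + 2)) = sInt x := fun x h1 h2 => sInt_add_period (k := k + 1) h1 h2
  have shift : ∀ y, m ≤ y + 1 → y + f (2 * k) < f (2 * k + 5) →
      sInt (y + f (2 * k + 2) + f (2 * k)) - sInt (y + f (2 * k + 2)) =
        sInt (y + f (2 * k)) - sInt y := fun y h1 h2 => by
    rw [add_right_comm, per y (by omega) (by omega), per (y + f (2 * k)) (by omega) (by omega)]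
  refine ⟨fun x h1 h2 => sub_eq_zero.1 ?_, fun x hx => ?_, fun x h1 h2 => ?_⟩
  · rcases lt_or_ge x (f (2 * k + 4)) with h | h
    · exact d0 x h1 h
    · obtain ⟨y, rfl⟩ := Nat.exists_eq_add_of_le h
      rw [show f (2 * k + 4) + y = f (2 * k + 3) + y + f (2 * k + 2) by omega, per _ (by omega)
        (by omega), add_right_comm _ (f (2 * k + 2)), per _ (by omega) (by omega),
        sInt_sub_eq (by omega), if_neg (by omega), if_neg (by omega)]
  · rw [show m + x = f (2 * k + 1) / 2 + f (2 * k + 3) + f (2 * k + 2) by omega,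
      shift _ (by omega) (by omega), sInt_sub_eq (by omega), if_neg (by omega),
      if_pos (by omega)]
  · obtain ⟨y, rfl⟩ := Nat.exists_eq_add_of_le' h1
    rw [← add_assoc, shift _ (by omega) (by omega)]
    exact d0 _ (by omega) (by omega)

/-- Both determinants are read off at a common place `m`, where `natDet_hankel_step` applies. -/
theorem natDet_hankel_period_step (k : ℕ) :
    ((f (2 * k + 1) / 2 : ℕ) : ℤ) *
        natDet (f (2 * k + 2)) (fun i l => sInt (f (2 * k + 3) + i + l)) =
      ((f (2 * k + 3) / 2 : ℕ) : ℤ) *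
        ((-1) ^ (f (2 * k + 1) * (f (2 * k + 1) - 1) / 2) * ((-1) ^ k) ^ f (2 * k + 1) *
          natDet (f (2 * k)) fun i l => sInt (f (2 * k + 1) + i + l)) := by
  have e2 : f (2 * k + 2) = f (2 * k) + f (2 * k + 1) := by rw [f_rec_even, add_comm]
  have e3 := f_rec_odd k
  have e4 : f (2 * k + 4) = f (2 * k + 3) + f (2 * k + 2) := f_rec_even (k + 1)
  have e5 : f (2 * k + 5) = f (2 * k + 4) + f (2 * k + 2) := f_rec_odd (k + 1)
  have p0 := f_pos (2 * k)
  have le1 := f_odd_le k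
  have par0 := (f_even_mod k).1
  have par1 := (f_even_mod k).2
  have par2 : f (2 * k + 2) % 2 = 1 := (f_even_mod (k + 1)).1
  have s3 : ∀ y < f (2 * k + 2), sInt (f (2 * k + 3) + y) = sInt y := fun y hy =>
    sInt_f_odd_add (k := k + 1) hy
  have s4 : ∀ y < f (2 * k + 2), sInt (f (2 * k + 4) + y) = sInt y := fun y hy =>
    sInt_f_even_add (k := k + 1) hy
  have per' : ∀ x, f (2 * k + 3) ≤ x → x < f (2 * k + 5) →
      sInt (x + f (2 * k + 2)) = sInt x := fun x h1 h2 => sInt_add_period (k := k + 1) h1 h2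
  obtain ⟨m, hm⟩ : ∃ m, m = f (2 * k + 1) / 2 + f (2 * k + 3) + 1 := ⟨_, rfl⟩
  obtain ⟨d0, d1, d2⟩ := sInt_sub_window hm
  have p1 := f_pos (2 * k + 1)
  have hmu : m ≤ f (2 * k + 3) + f (2 * k + 1) := by omega
  have hdet' : natDet (f (2 * k + 2)) (fun i l => sInt (m + i + l)) =
      natDet (f (2 * k + 2)) fun i l => sInt (f (2 * k + 3) + i + l) :=
    natDet_hankel_eq_of_periodic (a := f (2 * k + 3)) (b := m) (Nat.odd_iff.2 par2) (by omega)
      fun x h1 h2 => per' x h1 (by omega)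
  have hdet : natDet (f (2 * k)) (fun i l => sInt (f (2 * k + 1) + i + l)) =
      natDet (f (2 * k)) fun i l => sInt (m + i + l) := by
    refine Eq.trans ?_ (natDet_hankel_eq_of_periodic (Nat.odd_iff.2 par0) hmu
      fun x h1 h2 => d0 x h1 (by omega))
    refine natDet_congr fun i hi l hl => ?_
    rcases lt_or_ge (i + l) (f (2 * k)) with h | h
    · rw [add_assoc, add_assoc, add_assoc, s3 _ (by omega)]
    · obtain ⟨z, hz⟩ := Nat.exists_eq_add_of_le h
      rw [show f (2 * k + 3) + f (2 * k + 1) + i + l = f (2 * k + 4) + z by omega,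
        s4 _ (by omega), show f (2 * k + 1) + i + l = f (2 * k + 2) + z by omega,
        sInt_f_even_add (by omega)]
  have hsum : ∀ i < f (2 * k), ∑ l ∈ Finset.range (f (2 * k)), sInt (m + i + l) =
      ((f (2 * k + 1) / 2 : ℕ) : ℤ) := by
    intro i hi
    have w1 := sum_window_eq_of_periodic (g := sInt) (p := f (2 * k)) (a := m) (b := m + i)
      (by omega) fun x h1 h2 => d0 x h1 (by omega)
    have w2 := sum_window_eq_of_periodic (g := sInt) (p := f (2 * k)) (a := m) hmu
      fun x h1 h2 => d0 x h1 (by omega)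
    rw [w1, ← w2, ← sum_sInt]
    refine Finset.sum_congr rfl fun l hl => ?_
    have := Finset.mem_range.1 hl
    rw [add_assoc, s3 _ (by omega), sInt_f_odd_add this]
  have hsum' : ∀ i < f (2 * k + 2), ∑ l ∈ Finset.range (f (2 * k + 2)), sInt (m + i + l) =
      ((f (2 * k + 3) / 2 : ℕ) : ℤ) := by
    intro i hi
    have w1 := sum_window_eq_of_periodic (g := sInt) (p := f (2 * k + 2)) (a := f (2 * k + 3))
      (b := m + i) (by omega) fun x h1 h2 => per' x h1 (by omega)
    rw [w1]
    refine Eq.trans ?_ (sum_sInt (k + 1))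
    exact Finset.sum_congr rfl fun l hl => s3 _ (Finset.mem_range.1 hl)
  rw [hdet, ← hdet', e2]
  rw [e2] at hsum' d1 d2
  exact natDet_hankel_step p0 hsum hsum'
    (fun x hx => sub_eq_zero.2 (d0 _ (by omega) (by omega))) d1 d2

/-- The Hankel determinant of the periodic word `τ^k(1)^∞`; the word `τ^k(11)` occurs in `s` at
`f (2 * k + 1) = |τ^k(10)|`. -/
theorem natDet_hankel_period (k : ℕ) :
    natDet (f (2 * k)) (fun i l => sInt (f (2 * k + 1) + i + l)) =
      (-1) ^ (k + 1) * (-1) ^ ((f (2 * k + 2) - 1) / 2) * ((f (2 * k + 1) / 2 : ℕ) : ℤ) := by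
  induction k with
  | zero =>
    change natDet 1 (fun i l => sInt (2 + i + l)) = _
    rw [natDet_one]
    rfl
  | succ k ih =>
    have e2 := f_rec_even k
    have e3 := f_rec_odd k
    have e4 : f (2 * k + 4) = f (2 * k + 3) + f (2 * k + 2) := f_rec_even (k + 1)
    have p1 := f_pos (2 * k + 1)
    have par1 := (f_even_mod k).2
    obtain ⟨par2, par3⟩ : f (2 * k + 2) % 2 = 1 ∧ f (2 * k + 3) % 2 = 0 := f_even_mod (k + 1)
    change natDet (f (2 * k + 2)) (fun i l => sInt (f (2 * k + 3) + i + l)) =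
      (-1) ^ (k + 1 + 1) * (-1) ^ ((f (2 * k + 4) - 1) / 2) * ((f (2 * k + 3) / 2 : ℕ) : ℤ)
    have step := natDet_hankel_period_step k
    rw [ih] at step
    obtain ⟨h, hh⟩ : ∃ h, f (2 * k + 1) = 2 * h := ⟨f (2 * k + 1) / 2, by omega⟩
    obtain ⟨h', hh'⟩ : ∃ h', f (2 * k + 3) = 2 * h' := ⟨f (2 * k + 3) / 2, by omega⟩
    obtain ⟨t, ht⟩ : ∃ t, f (2 * k + 2) = 2 * t + 1 := ⟨f (2 * k + 2) / 2, by omega⟩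
    have hpos : (h : ℤ) ≠ 0 := by exact_mod_cast (by omega : h ≠ 0)
    rw [show (f (2 * k + 4) - 1) / 2 = h' + t by omega,
      show f (2 * k + 3) / 2 = h' by omega]
    rw [show (f (2 * k + 2) - 1) / 2 = t by omega, show f (2 * k + 1) / 2 = h by omega,
      show f (2 * k + 3) / 2 = h' by omega, hh] at step
    refine mul_left_cancel₀ hpos (step.trans ?_)
    have q1 : ((-1 : ℤ) ^ k) ^ (2 * h) = 1 := by
      rw [← pow_mul]
      exact Even.neg_one_pow ⟨k * h, by ring⟩
    have q2 : (-1 : ℤ) ^ (2 * h * (2 * h - 1) / 2) = (-1) ^ h := by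
      rw [mul_assoc, Nat.mul_div_cancel_left _ two_pos, mul_comm, pow_mul,
        Odd.neg_one_pow ⟨h - 1, by omega⟩]
    -- `h + h' = f (2 * k + 2)` is odd
    have q3 : (-1 : ℤ) ^ h = -(-1) ^ h' := by
      have h4 : (-1 : ℤ) ^ h * (-1) ^ h' = -1 := by
        rw [← pow_add]
        exact Odd.neg_one_pow ⟨t, by omega⟩
      have h5 : (-1 : ℤ) ^ h' * (-1) ^ h' = 1 := by
        rw [← pow_add]
        exact Even.neg_one_pow ⟨h', rfl⟩
      linear_combination (-1 : ℤ) ^ h' * h4 - (-1 : ℤ) ^ h * h5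
    rw [q1, q2, q3]
    ring

/-! ### The boundary and the interior of a parallelogram -/

theorem H_eq_natDet (m n : ℕ) : H m n = natDet n fun i l => sInt (m + i + l) := rfl

/-- Around a point of `E'_(k+1)` the sequence `s` has period `f (2 * k)` on a maximal run, with one
break at each end. The run contains a copy of `τ^k(11)`, so all Hankel determinants of size
`f (2 * k)` inside it have the value of `natDet_hankel_period`. -/
theorem exists_run_of_mem_EPrime {k a : ℕ} (ha : a ∈ EPrime (k + 1)) :
    f (2 * k + 3) ≤ a ∧
    (∀ x, a + 1 ≤ x + f (2 * k + 3) → x + 2 ≤ a → sInt (x + f (2 * k)) = sInt x) ∧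
    (∀ x, x + f (2 * k + 3) = a → sInt (x + f (2 * k)) - sInt x = (-1) ^ k) ∧
    (∀ x, x + 1 = a → sInt (x + f (2 * k)) - sInt x = -(-1) ^ k) ∧
    (∀ m, a + 1 ≤ m + f (2 * k + 3) → m + f (2 * k) ≤ a → H m (f (2 * k)) =
      (-1) ^ (k + 1) * (-1) ^ ((f (2 * k + 2) - 1) / 2) * ((f (2 * k + 1) / 2 : ℕ) : ℤ)) ∧
    ∀ b < f (2 * k + 2), Phi (k + 1) (a - b) + b = f (2 * k + 5) / 2 := by
  obtain ⟨Y, hY, hs⟩ := exists_base_of_mem_EPrime ha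
  simp only [show 2 * (k + 1) + 3 = 2 * k + 5 by ring, show 2 * (k + 1) + 2 = 2 * k + 4 by ring]
    at hY hs
  have e2 := f_rec_even k
  have e3 := f_rec_odd k
  have e4 : f (2 * k + 4) = f (2 * k + 3) + f (2 * k + 2) := f_rec_even (k + 1)
  have e5 : f (2 * k + 5) = f (2 * k + 4) + f (2 * k + 2) := f_rec_odd (k + 1)
  have p0 := f_pos (2 * k)
  have p1 := f_pos (2 * k + 1)
  obtain ⟨par0, par1⟩ := f_even_mod k
  have hs' : ∀ x < f (2 * k + 4), sInt (Y + x) = sInt x := fun x hx => by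
    rw [sInt, (hs x hx).1, sInt]
  have hmid : f (2 * k + 5) / 2 = f (2 * k + 1) / 2 + f (2 * k + 3) := by omega
  have hd : ∀ x < f (2 * k + 3) + f (2 * k + 1),
      sInt (Y + x + f (2 * k)) - sInt (Y + x) = sInt (x + f (2 * k)) - sInt x := fun x hx => by
    rw [add_assoc, hs' _ (by omega), hs' _ (by omega)]
  have hper : ∀ x, a + 1 ≤ x + f (2 * k + 3) → x + 2 ≤ a → sInt (x + f (2 * k)) = sInt x := by
    intro x h1 h2
    obtain ⟨y, rfl⟩ := Nat.exists_eq_add_of_le (show Y ≤ x by omega)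
    rw [← sub_eq_zero, hd _ (by omega), sInt_sub_eq (by omega), if_neg (by omega),
      if_neg (by omega)]
  refine ⟨by omega, hper, fun x hx => ?_, fun x hx => ?_, fun m h1 h2 => ?_, fun b hb => ?_⟩
  · rw [show x = Y + f (2 * k + 1) / 2 by omega, hd _ (by omega), sInt_sub_eq (by omega),
      if_neg (by omega), if_pos (by omega)]
  · rw [show x = Y + (f (2 * k + 1) / 2 + f (2 * k + 3) - 1) by omega, hd _ (by omega),
      sInt_sub_eq (by omega), if_pos (by omega)]
  · have hbase : natDet (f (2 * k)) (fun i l => sInt (Y + f (2 * k + 1) + i + l)) =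
        (-1) ^ (k + 1) * (-1) ^ ((f (2 * k + 2) - 1) / 2) * ((f (2 * k + 1) / 2 : ℕ) : ℤ) := by
      rw [← natDet_hankel_period]
      refine natDet_congr fun i hi l hl => ?_
      rw [add_assoc, add_assoc, hs' _ (by omega), add_assoc]
    rw [H_eq_natDet, ← hbase]
    rcases le_total m (Y + f (2 * k + 1)) with h | h
    · exact (natDet_hankel_eq_of_periodic (Nat.odd_iff.2 par0) h fun x hx hx' =>
        hper x (by omega) (by omega)).symm
    · exact natDet_hankel_eq_of_periodic (Nat.odd_iff.2 par0) h fun x hx hx' =>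
        hper x (by omega) (by omega)
  · rw [show a - b = Y + (f (2 * k + 5) / 2 - b) by omega, (hs _ (by omega)).2]
    omega

theorem neg_one_pow_eq_of_mod_two {a b : ℕ} (h : a % 2 = b % 2) : (-1 : ℤ) ^ a = (-1) ^ b := by
  rw [neg_one_pow_eq_pow_mod_two, h, ← neg_one_pow_eq_pow_mod_two]

theorem mul_mod_two (x y : ℕ) :
    x % 2 = 0 ∧ x * y % 2 = 0 ∨ x % 2 = 1 ∧ x * y % 2 = y % 2 := by
  rcases Nat.mod_two_eq_zero_or_one x with h | h <;> simp [Nat.mul_mod, h]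

theorem mul_pred_div_two_mod_two (e : ℕ) : e * (e - 1) / 2 % 2 = e / 2 % 2 := by
  rcases Nat.even_or_odd' e with ⟨u, rfl | rfl⟩
  · rw [mul_assoc, Nat.mul_div_cancel_left _ two_pos]
    have := mul_mod_two u (2 * u - 1)
    omega
  · rw [Nat.add_sub_cancel, mul_comm, mul_assoc, Nat.mul_div_cancel_left _ two_pos]
    have := mul_mod_two u (2 * u + 1)
    omega

/-- The value of a Hankel determinant of size `f (2 * k) + b + e` for which the period
`f (2 * k)` breaks on the left for `b` rows and on the right for `e` rows. -/
theorem H_border {k a m b e : ℕ} (ha : a ∈ EPrime (k + 1))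
    (hb : 0 < b → m + b + f (2 * k + 3) = a + 1)
    (he : 0 < e → m + b + (f (2 * k) + b + e) = a)
    (h1 : a + 1 ≤ m + b + f (2 * k + 3)) (h2 : m + b + (f (2 * k) + b + e) ≤ a) :
    H m (f (2 * k) + b + e) =
      (-1) ^ (e * (e - 1) / 2 + (k + 1) * e + b + b * (b - 1) / 2 + k * b + (k + 1) +
        (f (2 * k + 2) - 1) / 2) * ((f (2 * k + 1) : ℤ) / 2) := by
  obtain ⟨-, hper, hleft, hright, hdet, -⟩ := exists_run_of_mem_EPrime ha
  have hpb : (-1 : ℤ) ^ (f (2 * k) * b) = (-1) ^ b := by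
    rw [pow_mul, Odd.neg_one_pow (Nat.odd_iff.2 (f_even_mod k).1)]
  rw [H_eq_natDet, natDet_hankel_border (δ' := (-1) ^ k) (δ := (-1) ^ (k + 1)) (f_pos _)
    (fun x hx hx' => sub_eq_zero.2 (hper _ (by omega) (by omega)))
    (fun x hx => hleft _ (by omega))
    (fun x hx hx' => by rw [hright _ (by omega)]; ring),
    ← H_eq_natDet, hdet _ h1 (by omega), ← pow_mul, ← pow_mul,
    pow_add _ (f (2 * k) * b), hpb]
  push_cast
  ring

theorem alpha_mem_EPrime (k i : ℕ) : alpha k i ∈ EPrime (k + 1) :=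
  Nat.nth_mem_of_infinite (p := fun x => x ∈ EPrime (k + 1)) (EPrime_infinite (k + 1)) (i - 1)

/-- Here `b = a - (m + n)` rows meet the left break and the others meet the right one. -/
theorem H_top {k a m n : ℕ} (ha : a ∈ EPrime (k + 1)) (hn : n + 1 = f (2 * k + 3))
    (h1 : a < n + m + f (2 * k + 2)) (h2 : n + m ≤ a) :
    H m n = (-1) ^ (k + 1) *
      (((-1 : ℤˣ) ^ ((f (2 * k + 5) : ℤ) / 2 - (Phi (k + 1) (m + n) : ℤ)) : ℤˣ) : ℤ) *
        ((f (2 * k + 1) : ℤ) / 2) := by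
  have e3 := f_rec_odd k
  have par2 : f (2 * k + 2) % 2 = 1 := (f_even_mod (k + 1)).1
  obtain ⟨-, -, -, -, -, hphi⟩ := exists_run_of_mem_EPrime ha
  obtain ⟨b, rfl⟩ := Nat.exists_eq_add_of_le h2
  obtain ⟨e, he⟩ := Nat.exists_eq_add_of_le (show b + 1 ≤ f (2 * k + 2) by omega)
  have hz : (f (2 * k + 5) : ℤ) / 2 - (Phi (k + 1) (m + n) : ℤ) = (b : ℤ) := by
    have := hphi b (by omega)
    rw [Nat.add_sub_cancel, add_comm n m] at this
    omega
  have hH := H_border (k := k) (m := m) (b := b) (e := e) ha (fun _ => by omega)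
    (fun _ => by omega) (by omega) (by omega)
  rw [show f (2 * k) + b + e = n by omega] at hH
  rw [hH, hz, zpow_natCast]
  push_cast
  rw [← pow_add]
  congr 1
  apply neg_one_pow_eq_of_mod_two
  have q1 := mul_pred_div_two_mod_two e
  have q2 := mul_pred_div_two_mod_two b
  have q3 := mul_mod_two (k + 1) e
  have q4 := mul_mod_two k b
  generalize (k + 1) * e = x3, k * b = x4, e * (e - 1) / 2 = x1, b * (b - 1) / 2 = x2 at *
  rcases Nat.even_or_odd' b with ⟨u, rfl | rfl⟩
  · obtain ⟨v, rfl⟩ : ∃ v, e = 2 * v := ⟨e / 2, by omega⟩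
    rw [show (f (2 * k + 2) - 1) / 2 = u + v by omega]
    omega
  · obtain ⟨v, rfl⟩ : ∃ v, e = 2 * v + 1 := ⟨e / 2, by omega⟩
    rw [show (f (2 * k + 2) - 1) / 2 = u + v + 1 by omega]
    omega

/-- All rows of differences meet the same break. -/
theorem H_side {k a m n : ℕ} (ha : a ∈ EPrime (k + 1)) (hn : f (2 * k) < n)
    (hn' : n + 1 < f (2 * k + 3)) (h : m + n + f (2 * k + 2) = a + 1 ∨ m + n = a) :
    H m n = -((-1) ^ ((f (2 * k + 3) - n) * k) *
      (-1) ^ (((f (2 * k + 3) - 1 - n) * (f (2 * k + 3) - 2 - n)) / 2) *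
        ((f (2 * k + 1) : ℤ) / 2)) := by
  have e3 := f_rec_odd k
  have par2 : f (2 * k + 2) % 2 = 1 := (f_even_mod (k + 1)).1
  have ha' := (exists_run_of_mem_EPrime ha).1
  obtain ⟨j, rfl⟩ := Nat.exists_eq_add_of_le hn.le
  rw [show f (2 * k + 3) - 2 - (f (2 * k) + j) = f (2 * k + 3) - 1 - (f (2 * k) + j) - 1 by omega,
    ← pow_add, ← neg_mul, ← neg_one_mul ((-1 : ℤ) ^ _), ← pow_succ']
  have q1 := mul_pred_div_two_mod_two (f (2 * k + 3) - 1 - (f (2 * k) + j))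
  have q2 := mul_pred_div_two_mod_two j
  have q3 := mul_mod_two k j
  have q4 := mul_mod_two (k + 1) j
  have q5 := mul_mod_two (f (2 * k + 3) - (f (2 * k) + j)) k
  rcases h with h | h
  · have hH := H_border (k := k) (m := m) (b := j) (e := 0) ha (fun _ => by omega)
      (fun h0 => absurd h0 (lt_irrefl 0)) (by omega) (by omega)
    rw [add_zero] at hH
    rw [hH]
    congr 1
    apply neg_one_pow_eq_of_mod_two
    rw [zero_mul, mul_zero]
    omega
  · have hH := H_border (k := k) (m := m) (b := 0) (e := j) ha (fun h0 => absurd h0 (lt_irrefl 0))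
      (fun _ => by omega) (by omega) (by omega)
    rw [add_zero] at hH
    rw [hH]
    congr 1
    apply neg_one_pow_eq_of_mod_two
    rw [zero_mul, mul_zero]
    omega

theorem H_interior {k a m n : ℕ} (ha : a ∈ EPrime (k + 1)) (hn : n + 1 < f (2 * k + 3))
    (h1 : a + 1 < m + n + f (2 * k + 2)) (h2 : m + n < a) (hn' : f (2 * k) < n) : H m n = 0 := by
  have e3 := f_rec_odd k
  obtain ⟨ha', hper, -⟩ := exists_run_of_mem_EPrime ha
  rw [H_eq_natDet]
  -- `r` is the first row of differences that starts inside the run; the truncated subtraction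
  -- gives row `0` if the matrix starts inside the run
  exact natDet_hankel_eq_zero (r := a + 1 - f (2 * k + 3) - m) (f_pos (2 * k)) (by omega)
    fun l hl => hper _ (by omega) (by omega)

end HankelSturm

theorem theorem1 (k m n : ℕ) (hmn : (m, n) ∈ U k) :
    ((n : ℤ) = (f (2 * k + 3) : ℤ) - 1 →
      H m n = (-1) ^ (k + 1) *
        (((-1 : ℤˣ) ^ ((f (2 * k + 5) : ℤ) / 2 - (Phi (k + 1) (m + n) : ℤ)) : ℤˣ) : ℤ) *
          ((f (2 * k + 1) : ℤ) / 2)) ∧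
    (n = f (2 * k) →
      H m n = (-1) ^ (k + 1) * (-1) ^ ((f (2 * k + 2) - 1) / 2) * ((f (2 * k + 1) : ℤ) / 2)) ∧
    (f (2 * k) < n → (n : ℤ) < (f (2 * k + 3) : ℤ) - 1 →
      ((∃ i ≥ 1, (m : ℤ) + n = (alpha k i : ℤ) - f (2 * k + 2) + 1 ∨ m + n = alpha k i) →
        H m n = -((-1) ^ ((f (2 * k + 3) - n) * k) *
          (-1) ^ (((f (2 * k + 3) - 1 - n) * (f (2 * k + 3) - 2 - n)) / 2) *
            ((f (2 * k + 1) : ℤ) / 2))) ∧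
      ((¬ ∃ i ≥ 1, (m : ℤ) + n = (alpha k i : ℤ) - f (2 * k + 2) + 1 ∨ m + n = alpha k i) →
        H m n = 0)) := by
  have e3 := f_rec_odd k
  simp only [U, Set.mem_iUnion] at hmn
  obtain ⟨i, hi, h1, h2, h3, h4⟩ := hmn
  simp only at h1 h2 h3 h4
  have ha := alpha_mem_EPrime k i
  obtain ⟨-, -, -, -, hdet, -⟩ := exists_run_of_mem_EPrime ha
  refine ⟨fun hn => H_top ha (by omega) (by omega) h4, fun hn => ?_, fun hn hn' => ⟨?_, ?_⟩⟩
  · subst hn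
    rw [hdet m (by omega) (by omega), Int.natCast_div, Nat.cast_ofNat]
  · rintro ⟨i', -, h⟩
    exact H_side (alpha_mem_EPrime k i') hn (by omega) (by omega)
  · intro hne
    have h5 : (m : ℤ) + n ≠ (alpha k i : ℤ) - f (2 * k + 2) + 1 :=
      fun h => hne ⟨i, hi, Or.inl h⟩
    have h6 : m + n ≠ alpha k i := fun h => hne ⟨i, hi, Or.inr h⟩
    exact H_interior ha (by omega) (by omega) (by omega) hn
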